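/- Let $\Gamma$ be a discrete group and let $\ell\colon\Gamma\to[0,\infty)$ be a length function, i.e. $\ell(e)=0$, $\ell(\gamma^{-1})=\ell(\gamma)$ and $\ell(\gamma\eta)\le\ell(\gamma)+\ell(\eta)$ for all $\gamma,\eta\in\Gamma$. The group $\Gamma$ has the Rapid Decay Property (RD) with respect to $\ell$ if there are $C>0$ and an integer $p\ge 0$ such that $$\|\varphi\|_{C_r^*(\Gamma)}\le C\Big(\sum_{\gamma\in\Gamma}|\varphi(\gamma)|^2(1+\ell(\gamma))^{2p}\Big)^{1/2}\qquad\text{for all }\varphi\in C_c(\Gamma),$$ where $\|\varphi\|_{C_r^*(\Gamma)}$ is the operator norm of convolution by $\varphi$ on $\ell^2(\Gamma)$. An action $\alpha$ of $\Gamma$ on a $C^*$-algebra $A$ has RD with respect to $\ell$ if there are $C>0$ and an integer $p\ge 0$ such that $\|f\|_{A\rtimes_{\alpha,r}\Gamma}\le C\|f\|_{2,p,\ell}$ for all $f\in C_c(\Gamma,A)$, where $\|\cdot\|_{A\rtimes_{\alpha,r}\Gamma}$ is the norm of the reduced crossed product (the operator norm of $\xi\mapsto f*\xi$ on the Hilbert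 $A$-module $\ell^2(\Gamma,A)$) and $$\|f\|_{2,p,\ell}=\max\Big\{\Big\|\sum_{\gamma}\alpha_{\gamma^{-1}}\big(f(\gamma)^*f(\gamma)\big)(1+\ell(\gamma))^{2p}\Big\|^{1/2},\ \Big\|\sum_{\gamma}f(\gamma)f(\gamma)^*(1+\ell(\gamma))^{2p}\Big\|^{1/2}\Big\}.$$ Suppose that $\Gamma$ has RD with respect to $\ell$. Then: 1. for every $n$, the trivial action of $\Gamma$ on $M_n(\mathbb C)$ has RD with respect to $\ell$; 2. more generally, for every finite-dimensional $C^*$-algebra $A$, the trivial action of $\Gamma$ on $A$ has RD with respect to $\ell$. -/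

import Mathlib

open scoped ENNReal Matrix.Norms.L2Operator

noncomputable section

namespace RapidDecay

/-- Length functions on a discrete group. -/
structure IsLengthFunction {Γ : Type*} [Group Γ] (ℓ : Γ → ℝ) : Prop where
  nonneg : ∀ γ, 0 ≤ ℓ γ
  map_inv : ∀ γ, ℓ γ⁻¹ = ℓ γ
  map_one : ℓ 1 = 0
  map_mul_le : ∀ γ η, ℓ (γ * η) ≤ ℓ γ + ℓ η

section GroupRD

variable {Γ : Type*} [Group Γ]

theorem memℓp_translate (γ : Γ) (ξ : lp (fun _ : Γ => ℂ) 2) :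
    Memℓp (fun η : Γ => ξ (γ⁻¹ * η)) 2 := by
  have h := lp.memℓp ξ
  rw [memℓp_gen_iff (by norm_num)] at h ⊢
  exact (Equiv.mulLeft γ⁻¹).summable_iff.mpr h

/-- Left translation by `γ` on `ℓ²(Γ)`: `(leftTranslate γ ξ)(η) = ξ(γ⁻¹ η)`. -/
def leftTranslate (γ : Γ) :
    lp (fun _ : Γ => ℂ) 2 →L[ℂ] lp (fun _ : Γ => ℂ) 2 :=
  LinearMap.mkContinuous
    { toFun := fun ξ => ⟨fun η => ξ (γ⁻¹ * η), memℓp_translate γ ξ⟩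
      map_add' := fun ξ η => rfl
      map_smul' := fun c ξ => rfl }
    1 (fun ξ => by
      rw [one_mul]
      refine le_of_eq ?_
      rw [lp.norm_eq_tsum_rpow (by norm_num), lp.norm_eq_tsum_rpow (by norm_num)]
      exact congrArg (· ^ _)
        ((Equiv.mulLeft γ⁻¹).tsum_eq fun η => ‖ξ η‖ ^ (2 : ℝ≥0∞).toReal))

/-- The left regular representation of `C_c(Γ)` on `ℓ²(Γ)`. -/
def leftRegular (φ : Γ →₀ ℂ) :
    lp (fun _ : Γ => ℂ) 2 →L[ℂ] lp (fun _ : Γ => ℂ) 2 :=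
  φ.sum fun γ c => c • leftTranslate γ

/-- The Sobolev norm `(∑ |φ(γ)|² (1 + ℓ(γ))^{2p})^{1/2}` on `C_c(Γ)`. -/
def scalarSobolevNorm (ℓ : Γ → ℝ) (p : ℕ) (φ : Γ →₀ ℂ) : ℝ :=
  √(φ.sum fun γ c => ‖c‖ ^ 2 * (1 + ℓ γ) ^ (2 * p))

/-- Rapid decay of the group `Γ` with respect to `ℓ`; the left side of the inequality is the
norm of `φ` in the reduced group C⋆-algebra. -/
def GroupHasRD (ℓ : Γ → ℝ) : Prop :=
  ∃ C : ℝ, 0 < C ∧ ∃ p : ℕ, ∀ φ : Γ →₀ ℂ, ‖leftRegular φ‖ ≤ C * scalarSobolevNorm ℓ p φ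

end GroupRD

section ActionRD

variable {Γ : Type*} [Group Γ] {A : Type*} [NonUnitalCStarAlgebra A]

/-- Convolution on `C_c(Γ, A)` for the action `α`, i.e. the product determined by
`(a δ_γ) (b δ_η) = a α_γ(b) δ_{γη}`. -/
def convolution (α : Γ →* (A ≃⋆ₐ[ℂ] A)) (f g : Γ →₀ A) : Γ →₀ A :=
  f.sum fun γ a => g.sum fun η b => Finsupp.single (γ * η) (a * α γ b)

/-- The source Sobolev norm
`‖∑ α_{γ⁻¹}(f(γ)⋆ f(γ)) (1 + ℓ(γ))^{2p}‖^{1/2}`. -/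
def sobolevNormSource (α : Γ →* (A ≃⋆ₐ[ℂ] A)) (ℓ : Γ → ℝ) (p : ℕ) (f : Γ →₀ A) : ℝ :=
  √‖f.sum fun γ a => (((1 + ℓ γ) ^ (2 * p) : ℝ) : ℂ) • α γ⁻¹ (star a * a)‖

/-- The range Sobolev norm `‖∑ f(γ) f(γ)⋆ (1 + ℓ(γ))^{2p}‖^{1/2}`. -/
def sobolevNormRange (ℓ : Γ → ℝ) (p : ℕ) (f : Γ →₀ A) : ℝ :=
  √‖f.sum fun γ a => (((1 + ℓ γ) ^ (2 * p) : ℝ) : ℂ) • (a * star a)‖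

/-- The Sobolev norm `‖f‖_{2,p,ℓ}`. -/
def sobolevNorm (α : Γ →* (A ≃⋆ₐ[ℂ] A)) (ℓ : Γ → ℝ) (p : ℕ) (f : Γ →₀ A) : ℝ :=
  max (sobolevNormSource α ℓ p f) (sobolevNormRange ℓ p f)

/-- The norm of the Hilbert `A`-module `ℓ²(Γ, A)` on its dense subspace `C_c(Γ, A)`, whose inner
product is `⟨ξ, η⟩ = ∑ α_{γ⁻¹}(ξ(γ)⋆ η(γ)) = (ξ⋆ * η)(1)`. -/
def moduleNorm (α : Γ →* (A ≃⋆ₐ[ℂ] A)) (ξ : Γ →₀ A) : ℝ :=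
  √‖ξ.sum fun γ a => α γ⁻¹ (star a * a)‖

/-- The norm of `f ∈ C_c(Γ, A)` in the reduced crossed product `A ⋊_{α,r} Γ`: the operator norm
of `ξ ↦ f * ξ` on the Hilbert `A`-module `ℓ²(Γ, A)`, computed on the dense subspace
`C_c(Γ, A)`. -/
def reducedNorm (α : Γ →* (A ≃⋆ₐ[ℂ] A)) (f : Γ →₀ A) : ℝ≥0∞ :=
  ⨆ ξ : Γ →₀ A, ⨆ _ : moduleNorm α ξ ≤ 1, ENNReal.ofReal (moduleNorm α (convolution α f ξ))

/-- Rapid decay of the action `α` of `Γ` on `A` with respect to `ℓ`. -/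
def ActionHasRD (α : Γ →* (A ≃⋆ₐ[ℂ] A)) (ℓ : Γ → ℝ) : Prop :=
  ∃ C : ℝ, 0 < C ∧ ∃ p : ℕ, ∀ f : Γ →₀ A,
    reducedNorm α f ≤ ENNReal.ofReal (C * sobolevNorm α ℓ p f)

/-- The trivial action of `Γ` on `A`. -/
def trivialAction (Γ : Type*) [Group Γ] (A : Type*) [NonUnitalCStarAlgebra A] :
    Γ →* (A ≃⋆ₐ[ℂ] A) := 1

end ActionRD

end RapidDecay

end

namespace RapidDecay

/-! ### Sums of positive elements in finite dimension. -/

section Positive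

variable {A : Type*} [NonUnitalCStarAlgebra A]

/-! In finite dimension the C⋆-valued square sums defining the Sobolev and module norms are
comparable to the scalar sums `∑ w(γ)² ‖f γ‖²`. The nontrivial direction is
`exists_sum_mul_norm_sq_le`, a consequence of compactness of the unit sphere together with
positivity. Since the action is trivial, expanding in a basis turns convolution into finitely many
scalar convolutions of coordinate functions (`convolution_eq_sum_leftRegular`). RD of `Γ` bounds
each of these, and Cauchy–Schwarz over pairs of basis indices recombines them. The exponent `p` does
not change. -/

theorem exists_finset_near_normalized [FiniteDimensional ℂ A] :
    ∃ T : Finset A, ∀ x : A, ∃ k ∈ T, ‖x - (‖x‖ : ℂ) • k‖ ≤ ‖x‖ / 2 ∧ ‖x‖ * ‖k‖ = ‖x‖ := by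
  classical
  have : ProperSpace A := FiniteDimensional.proper ℂ A
  obtain ⟨t, hts, htf, hcov⟩ := (isCompact_sphere (0 : A) 1).finite_cover_balls
    (e := 1 / 2) (by norm_num)
  -- `0` handles `x = 0`, also when `A` is trivial and its unit sphere is empty.
  refine ⟨insert 0 htf.toFinset, fun x => ?_⟩
  by_cases hx : x = 0
  · exact ⟨0, by simp, by simp [hx], by simp [hx]⟩
  have hx' : ‖x‖ ≠ 0 := norm_ne_zero_iff.mpr hx
  have hu : ((‖x‖⁻¹ : ℝ) : ℂ) • x ∈ Metric.sphere (0 : A) 1 := by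
    simp [norm_smul, hx']
  obtain ⟨k, hk, hxk⟩ := Set.mem_iUnion₂.mp (hcov hu)
  have hk1 : ‖k‖ = 1 := by simpa using hts hk
  refine ⟨k, by simp [hk], ?_, by rw [hk1, mul_one]⟩
  rw [mem_ball_iff_norm] at hxk
  have hfac : x - (‖x‖ : ℂ) • k = (‖x‖ : ℂ) • (((‖x‖⁻¹ : ℝ) : ℂ) • x - k) := by
    rw [smul_sub, smul_smul]
    simp [hx]
  rw [hfac, norm_smul, Complex.norm_real, norm_norm]
  nlinarith [norm_nonneg x]

/-- In a finite-dimensional C⋆-algebra, the norm of a sum of positive elements dominates the sum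
of the norms, up to a constant. -/
theorem exists_sum_norm_le_norm_sum [PartialOrder A] [StarOrderedRing A]
    [FiniteDimensional ℂ A] :
    ∃ K : ℝ, 0 ≤ K ∧ ∀ {ι : Type*} (s : Finset ι) (x : ι → A), (∀ i ∈ s, 0 ≤ x i) →
      ∑ i ∈ s, ‖x i‖ ≤ K * ‖∑ i ∈ s, x i‖ := by
  classical
  obtain ⟨T, hT⟩ := exists_finset_near_normalized (A := A)
  choose k hkT hk hk1 using hT
  refine ⟨2 * T.card, by positivity, fun {ι} s x hx => ?_⟩
  -- Terms with a common direction `c` cannot cancel: their sum differs from `(∑ ‖x i‖) • c` by at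
  -- most half of `∑ ‖x i‖`. Positivity then bounds this partial sum by the full one.
  have hfib : ∀ c ∈ T, ∑ i ∈ s with k (x i) = c, ‖x i‖ ≤ 2 * ‖∑ i ∈ s, x i‖ := by
    intro c _
    set S := s.filter fun i => k (x i) = c with hS
    have hle : ‖∑ i ∈ S, x i‖ ≤ ‖∑ i ∈ s, x i‖ := by
      refine CStarAlgebra.norm_le_norm_of_nonneg_of_le
        (Finset.sum_nonneg fun i hi => hx i (Finset.mem_filter.mp hi).1) ?_
      exact Finset.sum_le_sum_of_subset_of_nonneg (Finset.filter_subset _ _)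
        fun i hi _ => hx i hi
    have hc : ∑ i ∈ S, ‖x i‖ = ‖∑ i ∈ S, (‖x i‖ : ℂ) • c‖ := by
      rw [← Finset.sum_smul, norm_smul, ← Complex.ofReal_sum, Complex.norm_real,
        Real.norm_of_nonneg (Finset.sum_nonneg fun _ _ => norm_nonneg _), Finset.sum_mul]
      refine Finset.sum_congr rfl fun i hi => ?_
      rw [← (Finset.mem_filter.mp hi).2, hk1]
    have hdiff : ‖∑ i ∈ S, (x i - (‖x i‖ : ℂ) • c)‖ ≤ ∑ i ∈ S, ‖x i‖ / 2 := by
      refine norm_sum_le_of_le _ fun i hi => ?_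
      rw [← (Finset.mem_filter.mp hi).2]
      exact hk _
    rw [Finset.sum_sub_distrib, ← Finset.sum_div, ← norm_neg, neg_sub] at hdiff
    have := norm_sub_norm_le (∑ i ∈ S, (‖x i‖ : ℂ) • c) (∑ i ∈ S, x i)
    linarith
  calc ∑ i ∈ s, ‖x i‖ = ∑ c ∈ T, ∑ i ∈ s with k (x i) = c, ‖x i‖ :=
        (Finset.sum_fiberwise_of_maps_to (fun i _ => hkT (x i)) _).symm
    _ ≤ ∑ _c ∈ T, 2 * ‖∑ i ∈ s, x i‖ := Finset.sum_le_sum hfib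
    _ = 2 * T.card * ‖∑ i ∈ s, x i‖ := by rw [Finset.sum_const, nsmul_eq_mul]; ring

/-- The spectral order is introduced inside the proof, so no order on `A` is assumed. Squared
weights are absorbed into `a i`, which makes every term positive. -/
theorem exists_sum_mul_norm_sq_le [FiniteDimensional ℂ A] :
    ∃ K : ℝ, 0 ≤ K ∧ ∀ {ι : Type*} (s : Finset ι) (w : ι → ℝ) (a : ι → A),
      ∑ i ∈ s, w i ^ 2 * ‖a i‖ ^ 2 ≤
        K * ‖∑ i ∈ s, ((w i ^ 2 : ℝ) : ℂ) • (star (a i) * a i)‖ := by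
  let _ := CStarAlgebra.spectralOrder A
  have := CStarAlgebra.spectralOrderedRing A
  obtain ⟨K, hK, h⟩ := exists_sum_norm_le_norm_sum (A := A)
  refine ⟨K, hK, fun s w a => ?_⟩
  have hsq : ∀ i, ((w i ^ 2 : ℝ) : ℂ) • (star (a i) * a i) =
      star ((w i : ℂ) • a i) * ((w i : ℂ) • a i) := fun i => by
    rw [star_smul, smul_mul_smul_comm, Complex.star_def, Complex.conj_ofReal,
      ← Complex.ofReal_mul, sq]
  refine le_trans (le_of_eq ?_) (h s _ fun i _ => hsq i ▸ star_mul_self_nonneg _)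
  refine Finset.sum_congr rfl fun i _ => ?_
  rw [norm_smul, CStarRing.norm_star_mul_self, Complex.norm_real,
    Real.norm_of_nonneg (sq_nonneg _), sq ‖a i‖]

end Positive

/-! ### The regular representation on `ℓ²(Γ)`. -/

section Scalar

variable {Γ : Type*}

/-- The inclusion of `C_c(Γ)` into `ℓ²(Γ)`. -/
def toLTwo (ψ : Γ →₀ ℂ) : lp (fun _ : Γ => ℂ) 2 :=
  ⟨fun γ => ψ γ, (memℓp_zero ψ.hasFiniteSupport).of_exponent_ge zero_le⟩

theorem toLTwo_apply (ψ : Γ →₀ ℂ) (γ : Γ) : toLTwo ψ γ = ψ γ := rfl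

theorem norm_toLTwo_sq (ψ : Γ →₀ ℂ) : ‖toLTwo ψ‖ ^ 2 = ψ.sum fun _ c => ‖c‖ ^ 2 := by
  have h := lp.norm_rpow_eq_tsum (p := 2) (by norm_num) (toLTwo ψ)
  simp only [ENNReal.toReal_ofNat, Real.rpow_ofNat] at h
  rw [h, tsum_eq_sum (s := ψ.support)]
  · rfl
  · intro γ hγ
    simp [toLTwo_apply, Finsupp.notMem_support_iff.mp hγ]

theorem sum_norm_sq_le_norm_sq (s : Finset Γ) (ξ : lp (fun _ : Γ => ℂ) 2) :
    ∑ γ ∈ s, ‖ξ γ‖ ^ 2 ≤ ‖ξ‖ ^ 2 := by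
  have h := lp.sum_rpow_le_norm_rpow (p := 2) (by norm_num) ξ s
  simpa only [ENNReal.toReal_ofNat, Real.rpow_ofNat] using h

theorem leftRegular_apply [Group Γ] (φ : Γ →₀ ℂ) (ξ : lp (fun _ : Γ => ℂ) 2) (γ : Γ) :
    leftRegular φ ξ γ = φ.sum fun η c => c * ξ (η⁻¹ * γ) := by
  simp only [leftRegular, Finsupp.sum, sum_apply, lp.coeFn_sum,
    Finset.sum_apply]
  rfl

end Scalar

/-! ### Reduction of the trivial action to coordinates. -/

section Action

variable {Γ A : Type*} [NonUnitalCStarAlgebra A]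

/-- The coordinate of `f ∈ C_c(Γ, A)` along a linear functional. -/
noncomputable def coordinate (c : A →L[ℂ] ℂ) (f : Γ →₀ A) : Γ →₀ ℂ := f.mapRange c (map_zero c)

theorem coordinate_sum_le (c : A →L[ℂ] ℂ) (f : Γ →₀ A) (w : Γ → ℝ) (hw : ∀ γ, 0 ≤ w γ) :
    ((coordinate c f).sum fun γ z => ‖z‖ ^ 2 * w γ) ≤
      ‖c‖ ^ 2 * ∑ γ ∈ f.support, w γ * ‖f γ‖ ^ 2 := by
  rw [coordinate, Finsupp.sum_mapRange_index (by simp), Finsupp.sum, Finset.mul_sum]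
  refine Finset.sum_le_sum fun γ _ => ?_
  calc ‖c (f γ)‖ ^ 2 * w γ ≤ (‖c‖ * ‖f γ‖) ^ 2 * w γ := by
        gcongr
        · exact hw γ
        · exact c.le_opNorm _
    _ = ‖c‖ ^ 2 * (w γ * ‖f γ‖ ^ 2) := by ring

variable [Group Γ]

theorem trivialAction_apply (γ : Γ) (a : A) : trivialAction Γ A γ a = a := rfl

theorem convolution_trivialAction_apply (f ξ : Γ →₀ A) (γ : Γ) :
    convolution (trivialAction Γ A) f ξ γ = f.sum fun η a => a * ξ (η⁻¹ * γ) := by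
  classical
  simp only [convolution, trivialAction_apply, Finsupp.sum, Finsupp.finsetSum_apply,
    Finsupp.single_apply]
  refine Finset.sum_congr rfl fun η _ => ?_
  simp only [← eq_inv_mul_iff_mul_eq, Finset.sum_ite_eq', Finsupp.mem_support_iff]
  split_ifs with h
  · rfl
  · simp [not_not.mp h]

theorem leftRegular_coordinate_apply (c d : A →L[ℂ] ℂ) (f ξ : Γ →₀ A) (γ : Γ) :
    leftRegular (coordinate c f) (toLTwo (coordinate d ξ)) γ =
      ∑ η ∈ f.support, c (f η) * d (ξ (η⁻¹ * γ)) := by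
  rw [leftRegular_apply, coordinate, Finsupp.sum_mapRange_index (by simp)]
  rfl

/-- Multiplication in `A` is bilinear and no `α γ` mixes the coordinates, so each pair of basis
vectors contributes one scalar convolution. -/
theorem convolution_eq_sum_leftRegular {ι : Type*} [Fintype ι] (b : Module.Basis ι ℂ A)
    (c : ι → A →L[ℂ] ℂ) (hc : ∀ i a, c i a = b.repr a i) (f ξ : Γ →₀ A) (γ : Γ) :
    convolution (trivialAction Γ A) f ξ γ = ∑ q : ι × ι,
      leftRegular (coordinate (c q.1) f) (toLTwo (coordinate (c q.2) ξ)) γ •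
        (b q.1 * b q.2) := by
  have hexp : ∀ a, a = ∑ i, c i a • b i := fun a => by simp only [hc, b.sum_repr]
  simp only [convolution_trivialAction_apply, leftRegular_coordinate_apply, Finset.sum_smul]
  rw [Finset.sum_comm]
  refine Finset.sum_congr rfl fun η _ => ?_
  dsimp only
  conv_lhs => rw [hexp (f η), hexp (ξ (η⁻¹ * γ))]
  rw [Finset.sum_mul_sum, Fintype.sum_prod_type]
  simp only [smul_mul_smul_comm]

theorem sobolevNormSource_trivialAction_sq (ℓ : Γ → ℝ) (p : ℕ) (f : Γ →₀ A) :
    sobolevNormSource (trivialAction Γ A) ℓ p f ^ 2 =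
      ‖∑ γ ∈ f.support, ((((1 + ℓ γ) ^ p) ^ 2 : ℝ) : ℂ) • (star (f γ) * f γ)‖ := by
  rw [sobolevNormSource, Real.sq_sqrt (norm_nonneg _)]
  simp only [trivialAction_apply, Finsupp.sum, ← pow_mul, mul_comm p]

theorem moduleNorm_trivialAction_sq (ξ : Γ →₀ A) :
    moduleNorm (trivialAction Γ A) ξ ^ 2 = ‖∑ γ ∈ ξ.support, star (ξ γ) * ξ γ‖ := by
  rw [moduleNorm, Real.sq_sqrt (norm_nonneg _)]
  rfl

theorem moduleNorm_trivialAction_sq_le (ξ : Γ →₀ A) :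
    moduleNorm (trivialAction Γ A) ξ ^ 2 ≤ ∑ γ ∈ ξ.support, ‖ξ γ‖ ^ 2 := by
  rw [moduleNorm_trivialAction_sq]
  refine norm_sum_le_of_le _ fun γ _ => ?_
  rw [CStarRing.norm_star_mul_self, sq]

/-- The trivial action of a group with rapid decay on a finite-dimensional C⋆-algebra has rapid
decay. -/
theorem GroupHasRD.trivialAction [FiniteDimensional ℂ A] {ℓ : Γ → ℝ} (hΓ : GroupHasRD ℓ) :
    ActionHasRD (trivialAction Γ A) ℓ := by
  obtain ⟨C, hC, p, hRD⟩ := hΓ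
  obtain ⟨K, hK, hsum⟩ := exists_sum_mul_norm_sq_le (A := A)
  set b := Module.finBasis ℂ A
  let c : Fin (Module.finrank ℂ A) → A →L[ℂ] ℂ := fun i =>
    LinearMap.toContinuousLinearMap (b.coord i)
  have hc : ∀ i a, c i a = b.repr a i := fun i a => rfl
  let ι := Fin (Module.finrank ℂ A) × Fin (Module.finrank ℂ A)
  let N : ℝ := (Finset.univ : Finset ι).card
  -- `N` comes from Cauchy–Schwarz over the pairs `q`; the last factor is the bound `hF` on each
  -- scalar convolution.
  let M : ℝ := N * ∑ q : ι, ‖b q.1 * b q.2‖ ^ 2 * (C * ‖c q.1‖ * ‖c q.2‖ * K) ^ 2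
  have hM : 0 ≤ M := by positivity
  -- The `+ 1` keeps the constant strictly positive when `M = 0`.
  refine ⟨√M + 1, by positivity, p, fun f => iSup₂_le fun ξ hξ => ENNReal.ofReal_le_ofReal ?_⟩
  set S := sobolevNorm (RapidDecay.trivialAction Γ A) ℓ p f with hS
  have hS0 : 0 ≤ S := le_max_of_le_left (Real.sqrt_nonneg _)
  -- The source half of the Sobolev norm alone suffices here.
  have hf : ∑ γ ∈ f.support, ((1 + ℓ γ) ^ p) ^ 2 * ‖f γ‖ ^ 2 ≤ K * S ^ 2 := by
    refine (hsum _ _ _).trans ?_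
    rw [← sobolevNormSource_trivialAction_sq]
    gcongr
    · exact Real.sqrt_nonneg _
    · exact le_max_left _ _
  have hξ' : ∑ γ ∈ ξ.support, (1 : ℝ) * ‖ξ γ‖ ^ 2 ≤ K := by
    have h := hsum ξ.support (fun _ => 1) ξ
    simp only [one_pow, Complex.ofReal_one, one_smul, ← moduleNorm_trivialAction_sq] at h
    exact h.trans (mul_le_of_le_one_right hK (pow_le_one₀ (Real.sqrt_nonneg _) hξ))
  have hφ : ∀ i, ‖leftRegular (coordinate (c i) f)‖ ^ 2 ≤ C ^ 2 * (‖c i‖ ^ 2 * (K * S ^ 2)) := by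
    intro i
    have h1 := pow_le_pow_left₀ (norm_nonneg _) (hRD (coordinate (c i) f)) 2
    have h2 := coordinate_sum_le (c i) f (fun γ => ((1 + ℓ γ) ^ p) ^ 2) fun _ => sq_nonneg _
    simp only [← pow_mul, mul_comm p] at h2 hf
    rw [mul_pow, scalarSobolevNorm, Real.sq_sqrt] at h1
    · refine h1.trans ?_
      gcongr
      exact h2.trans (by gcongr)
    · refine Finset.sum_nonneg fun γ _ => ?_
      dsimp only
      rw [pow_mul]
      positivity
  have hψ : ∀ i, ‖toLTwo (coordinate (c i) ξ)‖ ^ 2 ≤ ‖c i‖ ^ 2 * K := by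
    intro i
    have h := coordinate_sum_le (c i) ξ (fun _ => 1) fun _ => zero_le_one
    simp only [mul_one] at h
    rw [norm_toLTwo_sq]
    exact h.trans (by gcongr)
  set g := convolution (RapidDecay.trivialAction Γ A) f ξ with hg
  let F : ι → lp (fun _ : Γ => ℂ) 2 := fun q =>
    leftRegular (coordinate (c q.1) f) (toLTwo (coordinate (c q.2) ξ))
  have hF : ∀ q, ‖F q‖ ^ 2 ≤ (C * ‖c q.1‖ * ‖c q.2‖ * K) ^ 2 * S ^ 2 := by
    intro q
    calc ‖F q‖ ^ 2 ≤ (‖leftRegular (coordinate (c q.1) f)‖ *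
          ‖toLTwo (coordinate (c q.2) ξ)‖) ^ 2 := by
          gcongr
          exact ContinuousLinearMap.le_opNorm _ _
      _ ≤ (C ^ 2 * (‖c q.1‖ ^ 2 * (K * S ^ 2))) * (‖c q.2‖ ^ 2 * K) := by
          rw [mul_pow]
          exact mul_le_mul (hφ _) (hψ _) (sq_nonneg _) (by positivity)
      _ = _ := by ring
  have hgγ : ∀ γ, ‖g γ‖ ^ 2 ≤ N * ∑ q : ι, ‖b q.1 * b q.2‖ ^ 2 * ‖F q γ‖ ^ 2 := by
    intro γ
    have h1 : ‖g γ‖ ≤ ∑ q : ι, ‖b q.1 * b q.2‖ * ‖F q γ‖ := by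
      rw [hg, convolution_eq_sum_leftRegular b c hc]
      refine norm_sum_le_of_le _ fun q _ => ?_
      rw [norm_smul, mul_comm]
    refine (pow_le_pow_left₀ (norm_nonneg _) h1 2).trans ?_
    simp only [← mul_pow]
    exact sq_sum_le_card_mul_sum_sq
  have hmain : moduleNorm (RapidDecay.trivialAction Γ A) g ^ 2 ≤ M * S ^ 2 := by
    calc moduleNorm (RapidDecay.trivialAction Γ A) g ^ 2
        ≤ ∑ γ ∈ g.support, ‖g γ‖ ^ 2 := moduleNorm_trivialAction_sq_le g
      _ ≤ ∑ γ ∈ g.support, N * ∑ q : ι, ‖b q.1 * b q.2‖ ^ 2 * ‖F q γ‖ ^ 2 :=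
          Finset.sum_le_sum fun γ _ => hgγ γ
      _ = N * ∑ q : ι, ‖b q.1 * b q.2‖ ^ 2 * ∑ γ ∈ g.support, ‖F q γ‖ ^ 2 := by
          simp only [← Finset.mul_sum]
          rw [Finset.sum_comm]
          simp only [Finset.mul_sum]
      _ ≤ N * ∑ q : ι, ‖b q.1 * b q.2‖ ^ 2 *
            ((C * ‖c q.1‖ * ‖c q.2‖ * K) ^ 2 * S ^ 2) := by
          gcongr with q
          exact (sum_norm_sq_le_norm_sq _ _).trans (hF q)
      _ = M * S ^ 2 := by
          simp only [M, mul_assoc, Finset.sum_mul]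
  calc moduleNorm (RapidDecay.trivialAction Γ A) g ≤ √(M * S ^ 2) := Real.le_sqrt_of_sq_le hmain
    _ = √M * S := by rw [Real.sqrt_mul hM, Real.sqrt_sq hS0]
    _ ≤ (√M + 1) * S := by gcongr; linarith

end Action

end RapidDecay

theorem mainTheorem9 {Γ : Type*} [Group Γ] (ℓ : Γ → ℝ) (hℓ : RapidDecay.IsLengthFunction ℓ)
    (hΓ : RapidDecay.GroupHasRD ℓ) :
    (∀ n : ℕ, RapidDecay.ActionHasRD
      (RapidDecay.trivialAction Γ (Matrix (Fin n) (Fin n) ℂ)) ℓ) ∧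
    (∀ (A : Type*) [NonUnitalCStarAlgebra A] [FiniteDimensional ℂ A],
      RapidDecay.ActionHasRD (RapidDecay.trivialAction Γ A) ℓ) :=
  ⟨fun _ => hΓ.trivialAction, fun _ _ _ => hΓ.trivialAction⟩
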